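/- Let $f(z)=\sum_{\alpha\in A}c_\alpha z^\alpha$ be a complex Laurent polynomial in $z_1,\dots,z_n$, where $A\subset\mathbb Z^n$ is finite and all $c_\alpha\neq 0$, and let $\Delta_f=\operatorname{Conv}(A)\subset\mathbb R^n$ be its Newton polytope. The coamoeba $\mathcal A'(f)\subset\mathbf T^n=(\mathbb R/2\pi\mathbb Z)^n$ is the image of the zero locus $\{z\in(\mathbb C^*)^n : f(z)=0\}$ under $z\mapsto(\arg z_1,\dots,\arg z_n)$; it is also viewed as a $2\pi$-periodic subset of $\mathbb R^n$. Its closure is denoted $\overline{\mathcal A'}(f)$. For a (not necessarily proper) face $\Gamma$ of $\Delta_f$ put $f_\Gamma(z)=\sum_{\alpha\in A\cap\Gamma}c_\alpha z^\alpha$; an edge is a face of dimension one. The shell $\mathcal H(f)$ is the union of the coamoebas $\mathcal A'(f_\Gamma)$ over all edges $\Gamma$ of $\Delta_f$; it is a union of hyperplanes, and its cells are the connected components of its complement. (1) Let $l\subset\mathbb R^n$ be a line segment whose endpoints lie in the complement of $\overline{\mathcal A'}(f)$ and which intersects $\overline{\mathcal A'}(f)$, all sets being viewed in $\mathbb R^n$.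 Then $l$ intersects $\mathcal A'(f_\Gamma)$ for some edge $\Gamma$ of $\Delta_f$. (2) Each cell of $\mathcal H(f)$ contains at most one connected component of the complement of $\overline{\mathcal A'}(f)$. This holds both when all sets are viewed in $\mathbb R^n$ and when they are viewed in $\mathbf T^n$. -/

import Mathlib

noncomputable section

namespace Coamoeba

/-- Laurent polynomials in `z_1, …, z_n` with complex coefficients; the exponent vector `α` carries
the coefficient `f.coeff α`. -/
abbrev LaurentPoly (n : ℕ) : Type := AddMonoidAlgebra ℂ (Fin n → ℤ)

/-- The value `f(z) = ∑ c_α z^α` at a point `z` of the complex torus `(ℂ^*)^n`. -/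
def evalAt {n : ℕ} (f : LaurentPoly n) (z : Fin n → ℂˣ) : ℂ :=
  ∑ α ∈ f.coeff.support, f.coeff α * ∏ i, (z i : ℂ) ^ (α i)

/-- The zero locus `V(f) ⊆ (ℂ^*)^n`. -/
def zeroLocus {n : ℕ} (f : LaurentPoly n) : Set (Fin n → ℂˣ) :=
  {z | evalAt f z = 0}

/-- The real torus `T^n = (ℝ / 2πℤ)^n`. -/
abbrev Torus (n : ℕ) : Type := Fin n → Real.Angle

/-- The componentwise argument map `(ℂ^*)^n → T^n`. -/
def argMap {n : ℕ} (z : Fin n → ℂˣ) : Torus n :=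
  fun i => (Complex.arg (z i : ℂ) : Real.Angle)

/-- The coamoeba of `f`, a subset of `T^n`. -/
def coamoeba {n : ℕ} (f : LaurentPoly n) : Set (Torus n) :=
  argMap '' zeroLocus f

/-- A subset of `T^n` viewed as a multiply periodic subset of `ℝ^n`. -/
def periodicLift {n : ℕ} (S : Set (Torus n)) : Set (Fin n → ℝ) :=
  {θ | (fun i => (θ i : Real.Angle)) ∈ S}

/-- An integer vector regarded as a point of `ℝ^n`. -/
def toReal {n : ℕ} (α : Fin n → ℤ) : Fin n → ℝ := fun i => (α i : ℝ)

/-- The Newton polytope `Δ_f`, the convex hull of the support of `f`. -/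
def newtonPolytope {n : ℕ} (f : LaurentPoly n) : Set (Fin n → ℝ) :=
  convexHull ℝ (toReal '' (f.coeff.support : Set (Fin n → ℤ)))

/-- `Γ` is an edge of `Δ_f`: a face of dimension one. Faces are the sets of maximizers of a linear
functional; the zero functional gives `Δ_f` itself, which is thus an edge if it is a segment. -/
def IsEdge {n : ℕ} (f : LaurentPoly n) (Γ : Set (Fin n → ℝ)) : Prop :=
  IsExposed ℝ (newtonPolytope f) Γ ∧ Module.finrank ℝ (vectorSpan ℝ Γ) = 1

open Classical in
/-- The truncation `f_Γ`, the sum of the terms of `f` with exponent in `Γ`. -/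
def truncation {n : ℕ} (f : LaurentPoly n) (Γ : Set (Fin n → ℝ)) : LaurentPoly n :=
  AddMonoidAlgebra.ofCoeff (f.coeff.filter fun α => toReal α ∈ Γ)

/-- The shell of the coamoeba of `f`: the union of the coamoebas of the edges of `Δ_f`. -/
def shell {n : ℕ} (f : LaurentPoly n) : Set (Torus n) :=
  ⋃ Γ ∈ {Γ : Set (Fin n → ℝ) | IsEdge f Γ}, coamoeba (truncation f Γ)

/-- The set of connected components of the complement of `S`. For the shell, a union of
hyperplanes, these are the cells of the arrangement. -/
def complComponents {X : Type*} [TopologicalSpace X] (S : Set X) : Set (Set X) :=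
  {C | ∃ x ∈ Sᶜ, C = connectedComponentIn Sᶜ x}

end Coamoeba

end

noncomputable section

namespace Coamoeba

open Filter Topology Complex

variable {n : ℕ}

/-! Everything reduces to one statement: a segment that avoids the shell, with endpoints off the
closed coamoeba, avoids the closed coamoeba (`segment_avoids_closure_coamoeba`). Write `z = exp (y +
iθ)`. Avoiding the shell and avoiding the closed coamoeba at the endpoints are open conditions, so a
segment meeting the closed coamoeba can be moved to one that meets the coamoeba itself and has a
direction `v` separating the exponents. Now choose `u` generic and look at the zeros with `θ` on the
segment and `y` in a plane `x₀ + ⟨u, v⟩`. They form a compact set: if they escaped to infinity, the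
dominant terms would lie on a face which, by genericity of the plane, has collinear exponents.
Cancellation rules out a vertex, so the face is an edge, and the limiting argument would lie in its
coamoeba, hence in the shell. On this compact set maximize the coordinate `μ` along `u`. For fixed
`μ` the other two coordinates combine into one complex variable, in which `f` is entire. The maximal
zero is interior to the strip because the endpoints are off the coamoeba, and it is isolated by
compactness. By the open mapping theorem it persists for slightly larger `μ`, a contradiction. For
the cells, edge coamoebas are unions of parallel hyperplanes, so a segment joining two points of a
cell in `ℝ^n` avoids the shell. On the torus, paths in a cell are lifted to `ℝ^n`. -/

/-- The exponential sum `∑ c_α e^⟨α, y + iθ⟩` over a finite set of exponents. -/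
def expSum (A : Finset (Fin n → ℤ)) (c : (Fin n → ℤ) → ℂ) (y θ : Fin n → ℝ) : ℂ :=
  ∑ α ∈ A, c α * Complex.exp ((toReal α ⬝ᵥ y : ℝ) + (toReal α ⬝ᵥ θ : ℝ) * I)

lemma evalAt_eq_expSum (f : LaurentPoly n) (z : Fin n → ℂˣ) (y θ : Fin n → ℝ)
    (h : ∀ i, (z i : ℂ) = Complex.exp (y i + θ i * I)) :
    evalAt f z = expSum f.coeff.support f.coeff y θ := by
  unfold evalAt expSum
  refine Finset.sum_congr rfl fun α _ => ?_
  congr 1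
  have h2 : ∀ i, (z i : ℂ) ^ (α i) = Complex.exp ((α i : ℂ) * (y i + θ i * I)) := fun i => by
    rw [h i, Complex.exp_int_mul]
  simp only [h2]
  rw [← Complex.exp_sum]
  congr 1
  simp only [dotProduct, toReal]
  push_cast
  rw [Finset.sum_mul, ← Finset.sum_add_distrib]
  exact Finset.sum_congr rfl fun i _ => by ring

lemma mem_periodicLift_coamoeba (f : LaurentPoly n) (θ : Fin n → ℝ) :
    θ ∈ periodicLift (coamoeba f) ↔ ∃ y, expSum f.coeff.support f.coeff y θ = 0 := by
  constructor
  · rintro ⟨z, hz, hzθ⟩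
    refine ⟨fun i => Real.log ‖(z i : ℂ)‖, ?_⟩
    rw [← evalAt_eq_expSum f z]
    · exact hz
    · intro i
      have h1 : ((Complex.arg (z i : ℂ) : ℝ) : Real.Angle) = (θ i : Real.Angle) := congrFun hzθ i
      have hne : (z i : ℂ) ≠ 0 := (z i).ne_zero
      have h2 : Complex.exp (θ i * I) = Complex.exp (Complex.arg (z i : ℂ) * I) := by
        obtain ⟨k, hk⟩ := Real.Angle.angle_eq_iff_two_pi_dvd_sub.1 h1
        rw [Complex.exp_eq_exp_iff_exists_int]
        refine ⟨-k, ?_⟩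
        have : θ i = Complex.arg (z i : ℂ) - 2 * Real.pi * k := by linarith
        rw [this]; push_cast; ring
      rw [Complex.exp_add, h2, ← Complex.ofReal_exp, Real.exp_log (norm_pos_iff.2 hne)]
      exact (Complex.norm_mul_exp_arg_mul_I _).symm
  · rintro ⟨y, hy⟩
    refine ⟨fun i => Units.mk0 (Complex.exp (y i + θ i * I)) (Complex.exp_ne_zero _), ?_, ?_⟩
    · change evalAt f _ = 0
      rw [evalAt_eq_expSum f _ y θ (fun i => rfl), hy]
    · funext i
      simp only [argMap, Units.val_mk0]
      have : Complex.exp (y i + θ i * I) = (Real.exp (y i) : ℂ) *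
          (Real.Angle.cos (θ i : Real.Angle) + Real.Angle.sin (θ i : Real.Angle) * I) := by
        rw [Complex.exp_add, Complex.exp_mul_I]
        simp
      rw [this, Complex.arg_mul_cos_add_sin_mul_I_coe_angle (Real.exp_pos _)]

lemma toReal_injective : Function.Injective (toReal : (Fin n → ℤ) → Fin n → ℝ) := fun a b h => by
  funext i
  have := congrFun h i
  simpa [toReal] using this

lemma continuous_expSum (A : Finset (Fin n → ℤ)) (c : (Fin n → ℤ) → ℂ) :
    Continuous fun p : (Fin n → ℝ) × (Fin n → ℝ) => expSum A c p.1 p.2 := by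
  unfold expSum dotProduct
  fun_prop

/-! ### Dominant terms and limits of zeros -/

/-- Shifting all exponents by `v` multiplies an exponential sum by a unit. -/
lemma sum_shift_eq (A : Finset (Fin n → ℤ)) (c : (Fin n → ℤ) → ℂ) (v y θ : Fin n → ℝ) :
    ∑ α ∈ A, c α * (Real.exp ((toReal α - v) ⬝ᵥ y) : ℂ) * Complex.exp ((toReal α ⬝ᵥ θ : ℝ) * I) =
      Real.exp (-(v ⬝ᵥ y)) * expSum A c y θ := by
  unfold expSum
  rw [Finset.mul_sum]
  refine Finset.sum_congr rfl fun α _ => ?_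
  rw [sub_dotProduct, sub_eq_add_neg, Real.exp_add, Complex.exp_add]
  push_cast
  ring

/-- Along an ultrafilter of zeros whose arguments converge, the dominant terms of an exponential
sum survive in the limit. -/
lemma exists_dominant_limit {ι : Type*} (U : Ultrafilter ι) {A : Finset (Fin n → ℤ)}
    (hA : A.Nonempty) (c : (Fin n → ℤ) → ℂ) (y θ : ι → Fin n → ℝ) (θ₀ : Fin n → ℝ)
    (hz : ∀ᶠ i in U, expSum A c (y i) (θ i) = 0) (hθ : Tendsto θ U (𝓝 θ₀)) :
    ∃ α₀ ∈ A, ∃ ρ : (Fin n → ℤ) → ℝ,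
      (∀ α ∈ A, Tendsto (fun i => Real.exp ((toReal α - toReal α₀) ⬝ᵥ y i)) U (𝓝 (ρ α))) ∧
      ρ α₀ = 1 ∧
      (∀ᶠ i in U, ∀ α ∈ A, (toReal α - toReal α₀) ⬝ᵥ y i ≤ 0) ∧
      ∑ α ∈ A, c α * (ρ α : ℂ) * Complex.exp ((toReal α ⬝ᵥ θ₀ : ℝ) * I) = 0 := by
  classical
  -- Each index has a maximal exponent; as `A` is finite, the ultrafilter selects one that works
  -- eventually.
  have hmax : ∃ α₀ ∈ A, ∀ᶠ i in U, ∀ α ∈ A, (toReal α - toReal α₀) ⬝ᵥ y i ≤ 0 := by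
    have h : ∀ᶠ i in U, ∃ α₀ ∈ A, ∀ α ∈ A, (toReal α - toReal α₀) ⬝ᵥ y i ≤ 0 := by
      refine Eventually.of_forall fun i => ?_
      obtain ⟨α₀, h0, h1⟩ := A.exists_max_image (fun α => toReal α ⬝ᵥ y i) hA
      exact ⟨α₀, h0, fun α hα => by rw [sub_dotProduct]; linarith [h1 α hα]⟩
    by_contra hcon
    push Not at hcon
    have h2 : ∀ α₀ ∈ A, ∀ᶠ i in U, ¬ ∀ α ∈ A, (toReal α - toReal α₀) ⬝ᵥ y i ≤ 0 :=
      fun α₀ h0 => (hcon α₀ h0).mono fun i ⟨α, hα, h⟩ h' => absurd (h' α hα) (not_le.2 h)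
    have h3 := (eventually_all_finset A).2 h2
    obtain ⟨i, ⟨α₀, h0, h1⟩, h4⟩ := (h.and h3).exists
    exact h4 α₀ h0 h1
  obtain ⟨α₀, h0, hle⟩ := hmax
  have hlim : ∀ α ∈ A, ∃ r : ℝ,
      Tendsto (fun i => Real.exp ((toReal α - toReal α₀) ⬝ᵥ y i)) U (𝓝 r) := by
    intro α hα
    obtain ⟨r, -, hr⟩ := (isCompact_Icc (a := (0 : ℝ)) (b := 1)).ultrafilter_le_nhds
      (U.map fun i => Real.exp ((toReal α - toReal α₀) ⬝ᵥ y i)) (by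
        rw [le_principal_iff]
        change ∀ᶠ i in (U : Filter ι), _
        filter_upwards [hle] with i hi
        exact ⟨(Real.exp_pos _).le, Real.exp_le_one_iff.2 (hi α hα)⟩)
    exact ⟨r, hr⟩
  choose! ρ hρ using hlim
  refine ⟨α₀, h0, ρ, hρ, ?_, hle, ?_⟩
  · refine tendsto_nhds_unique (hρ α₀ h0) ?_
    simp
  · have ht : Tendsto (fun i => ∑ α ∈ A, c α * (Real.exp ((toReal α - toReal α₀) ⬝ᵥ y i) : ℂ) *
        Complex.exp ((toReal α ⬝ᵥ θ i : ℝ) * I)) U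
        (𝓝 (∑ α ∈ A, c α * (ρ α : ℂ) * Complex.exp ((toReal α ⬝ᵥ θ₀ : ℝ) * I))) := by
      refine tendsto_finsetSum _ fun α hα => ?_
      refine (tendsto_const_nhds.mul ((continuous_ofReal.tendsto _).comp (hρ α hα))).mul ?_
      have hc : Continuous fun θ : Fin n → ℝ => Complex.exp ((toReal α ⬝ᵥ θ : ℝ) * I) := by
        unfold dotProduct
        fun_prop
      exact (hc.tendsto θ₀).comp hθ
    refine tendsto_nhds_unique ht (tendsto_const_nhds.congr' ?_)
    filter_upwards [hz] with i hi
    rw [sum_shift_eq, hi, mul_zero]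

/-- If the dominant terms in `exists_dominant_limit` have collinear exponents, the limiting
equation says that the corresponding truncation has a zero with the limiting argument. -/
lemma exists_zero_of_collinear {ι : Type*} (U : Ultrafilter ι) {A S : Finset (Fin n → ℤ)}
    {c : (Fin n → ℤ) → ℂ} (hc : ∀ α ∈ A, c α ≠ 0) {y : ι → Fin n → ℝ} {θ₀ : Fin n → ℝ}
    {α₀ : Fin n → ℤ} (h0 : α₀ ∈ A) {ρ : (Fin n → ℤ) → ℝ}
    (hρ : ∀ α ∈ A, Tendsto (fun i => Real.exp ((toReal α - toReal α₀) ⬝ᵥ y i)) U (𝓝 (ρ α)))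
    (hρ0 : ρ α₀ = 1)
    (hsum : ∑ α ∈ A, c α * (ρ α : ℂ) * Complex.exp ((toReal α ⬝ᵥ θ₀ : ℝ) * I) = 0)
    (hSA : S ⊆ A) (hS : ∀ α ∈ A, ρ α ≠ 0 → α ∈ S)
    (hcol : ∀ α ∈ S, ∀ β ∈ S, β ≠ α₀ →
      ∃ k : ℝ, toReal α - toReal α₀ = k • (toReal β - toReal α₀)) :
    (∃ α₁ ∈ S, α₁ ≠ α₀) ∧ ∃ y', expSum S c y' θ₀ = 0 := by
  -- A single surviving term cannot cancel.
  have hex : ∃ α₁ ∈ A, α₁ ≠ α₀ ∧ ρ α₁ ≠ 0 := by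
    by_contra hcon
    push Not at hcon
    rw [Finset.sum_eq_single_of_mem α₀ h0 (fun β hβ hne => by simp [hcon β hβ hne])] at hsum
    simp [hρ0, hc α₀ h0] at hsum
  obtain ⟨α₁, h1, hne, hρ1⟩ := hex
  have h1S := hS α₁ h1 hρ1
  refine ⟨⟨α₁, h1S, hne⟩, ?_⟩
  set d : Fin n → ℝ := toReal α₁ - toReal α₀ with hd
  have hdne : d ⬝ᵥ d ≠ 0 := by
    intro h
    have := dotProduct_self_eq_zero.1 h
    exact hne (toReal_injective (sub_eq_zero.1 this))
  have hpos : 0 < ρ α₁ := lt_of_le_of_ne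
    (ge_of_tendsto (hρ α₁ h1) (Eventually.of_forall fun i => (Real.exp_pos _).le)) (Ne.symm hρ1)
  have hτ : Tendsto (fun i => d ⬝ᵥ y i) U (𝓝 (Real.log (ρ α₁))) := by
    have := (Real.continuousAt_log hρ1).tendsto.comp (hρ α₁ h1)
    simpa only [Function.comp_def, Real.log_exp] using this
  -- Scaled so that `y'` gives the right limit at `α₁`; collinearity then forces the right limit at
  -- every exponent of `S`.
  set y' : Fin n → ℝ := (Real.log (ρ α₁) / (d ⬝ᵥ d)) • d with hy'
  have hdy : d ⬝ᵥ y' = Real.log (ρ α₁) := by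
    rw [hy', dotProduct_smul, smul_eq_mul, div_mul_cancel₀ _ hdne]
  have hval : ∀ α ∈ S, ρ α = Real.exp ((toReal α - toReal α₀) ⬝ᵥ y') := by
    intro α hα
    obtain ⟨k, hk⟩ := hcol α hα α₁ h1S hne
    refine tendsto_nhds_unique (hρ α (hSA hα)) ?_
    rw [hk]
    simp only [smul_dotProduct, smul_eq_mul]
    rw [← hd, hdy]
    exact (Real.continuous_exp.tendsto _).comp (hτ.const_mul k)
  refine ⟨y', ?_⟩
  have h2 := sum_shift_eq S c (toReal α₀) y' θ₀
  have h3 : ∑ α ∈ S, c α * (Real.exp ((toReal α - toReal α₀) ⬝ᵥ y') : ℂ) *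
      Complex.exp ((toReal α ⬝ᵥ θ₀ : ℝ) * I) = 0 := by
    rw [← hsum, ← Finset.sum_subset hSA]
    · exact Finset.sum_congr rfl fun α hα => by rw [hval α hα]
    · intro α hα hαS
      have : ρ α = 0 := by
        by_contra h
        exact hαS (hS α hα h)
      simp [this]
  rw [h3] at h2
  rcases mul_eq_zero.1 h2.symm with h | h
  · exact absurd h (by exact_mod_cast (Real.exp_pos _).ne')
  · exact h

/-- The coamoeba of a polynomial with collinear exponents is closed. -/
lemma isClosed_setOf_expSum_eq_zero {S : Finset (Fin n → ℤ)} {c : (Fin n → ℤ) → ℂ}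
    (hc : ∀ α ∈ S, c α ≠ 0)
    (hcol : ∀ γ ∈ S, ∀ α ∈ S, ∀ β ∈ S, β ≠ γ →
      ∃ k : ℝ, toReal α - toReal γ = k • (toReal β - toReal γ)) :
    IsClosed {θ : Fin n → ℝ | ∃ y, expSum S c y θ = 0} := by
  rcases S.eq_empty_or_nonempty with rfl | hne
  · simp [expSum]
  rw [isClosed_iff_ultrafilter]
  intro θ₀ U hU hmem
  have h1 : ∀ θ : Fin n → ℝ, ∃ y, (∃ y, expSum S c y θ = 0) → expSum S c y θ = 0 := fun θ => by
    by_cases h : ∃ y, expSum S c y θ = 0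
    · exact ⟨h.choose, fun _ => h.choose_spec⟩
    · exact ⟨0, fun h' => absurd h' h⟩
  choose y hy using h1
  obtain ⟨α₀, h0, ρ, hρ, hρ0, -, hsum⟩ := exists_dominant_limit U hne c y id θ₀
    (by filter_upwards [hmem] with θ hθ using hy θ hθ) hU
  exact (exists_zero_of_collinear U hc h0 hρ hρ0 hsum subset_rfl (fun α hα _ => hα)
    (hcol α₀ h0)).2

/-! ### Generic directions and planes -/

lemma dense_setOf_dotProduct_ne_zero {w : Fin n → ℝ} (hw : w ≠ 0) :
    Dense {v : Fin n → ℝ | w ⬝ᵥ v ≠ 0} := by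
  have h := interior_eq_empty_iff_dense_compl (s := {v : Fin n → ℝ | w ⬝ᵥ v = 0})
  refine h.1 ?_
  by_contra hne
  let K : Submodule ℝ (Fin n → ℝ) :=
    { carrier := {v | w ⬝ᵥ v = 0}
      add_mem' := fun {a b} ha hb => by
        simp only [Set.mem_ofPred_eq] at *
        rw [dotProduct_add, ha, hb, add_zero]
      zero_mem' := by simp
      smul_mem' := fun r a ha => by
        simp only [Set.mem_ofPred_eq] at *
        rw [dotProduct_smul, ha, smul_zero] }
  have htop := Submodule.eq_top_of_nonempty_interior' K (Set.nonempty_iff_ne_empty.2 hne)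
  have hmem : w ∈ K := htop ▸ Submodule.mem_top
  exact hw (dotProduct_self_eq_zero.1 hmem)

/-- Vectors that are not orthogonal to any of finitely many nonzero vectors are dense. -/
lemma dense_setOf_forall_dotProduct_ne_zero {W : Set (Fin n → ℝ)} (hW : W.Finite)
    (h0 : ∀ w ∈ W, w ≠ 0) : Dense {v : Fin n → ℝ | ∀ w ∈ W, w ⬝ᵥ v ≠ 0} := by
  have h := dense_biInter_of_isOpen (S := W) (f := fun w => {v : Fin n → ℝ | w ⬝ᵥ v ≠ 0})
    (fun w _ => by
      refine isOpen_ne_fun ?_ continuous_const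
      unfold dotProduct
      fun_prop) hW.countable (fun w hw => dense_setOf_dotProduct_ne_zero (h0 w hw))
  convert h using 1
  ext v
  simp

/-- A direction is separating for `A` if it takes different values on different exponents. -/
def Separates (A : Finset (Fin n → ℤ)) (v : Fin n → ℝ) : Prop :=
  ∀ α ∈ A, ∀ β ∈ A, α ≠ β → (toReal α - toReal β) ⬝ᵥ v ≠ 0

lemma dense_separates (A : Finset (Fin n → ℤ)) : Dense {v : Fin n → ℝ | Separates A v} := by
  have h := dense_setOf_forall_dotProduct_ne_zero
    (W := (fun p : (Fin n → ℤ) × (Fin n → ℤ) => toReal p.1 - toReal p.2) ''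
      ((A ×ˢ A).filter fun p => p.1 ≠ p.2 : Finset _))
    ((Finset.finite_toSet _).image _) (by
      rintro _ ⟨p, hp, rfl⟩
      exact fun h => (Finset.mem_filter.1 hp).2 (toReal_injective (sub_eq_zero.1 h)))
  refine h.mono fun v hv => ?_
  rw [Set.mem_ofPred_eq] at hv ⊢
  exact fun α hα β hβ hne => hv _
    ⟨(α, β), Finset.mem_filter.2 ⟨Finset.mk_mem_product hα hβ, hne⟩, rfl⟩

/-- The plane spanned by `u` and `v` contains no nonzero vector orthogonal to two independent
differences of exponents. -/
def GenericPlane (A : Finset (Fin n → ℤ)) (u v : Fin n → ℝ) : Prop :=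
  ∀ α ∈ A, ∀ β ∈ A, ∀ γ ∈ A, β ≠ γ → ∀ p q : ℝ, (p ≠ 0 ∨ q ≠ 0) →
    (toReal α - toReal γ) ⬝ᵥ (p • u + q • v) = 0 → (toReal β - toReal γ) ⬝ᵥ (p • u + q • v) = 0 →
    ∃ k : ℝ, toReal α - toReal γ = k • (toReal β - toReal γ)

/-- A vector of the plane orthogonal to two differences solves a 2×2 linear system. Its determinant
is `g ⬝ᵥ u`, where `g` vanishes only for parallel differences, so it suffices that `u` avoid
finitely many hyperplanes. -/
lemma exists_genericPlane {A : Finset (Fin n → ℤ)} {v : Fin n → ℝ} (hv : Separates A v) :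
    ∃ u, GenericPlane A u v := by
  classical
  let g : (Fin n → ℤ) × (Fin n → ℤ) × (Fin n → ℤ) → Fin n → ℝ := fun t =>
    ((toReal t.2.1 - toReal t.2.2) ⬝ᵥ v) • (toReal t.1 - toReal t.2.2) -
      ((toReal t.1 - toReal t.2.2) ⬝ᵥ v) • (toReal t.2.1 - toReal t.2.2)
  obtain ⟨u, hu⟩ := (dense_setOf_forall_dotProduct_ne_zero
    (W := {w ∈ (g '' (A ×ˢ A ×ˢ A : Finset _)) | w ≠ 0})
    (((Finset.finite_toSet _).image _).subset (Set.sep_subset _ _)) (fun w hw => hw.2)).nonempty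
  refine ⟨u, fun α hα β hβ γ hγ hne p q hpq h1 h2 => ?_⟩
  have hb2 := hv β hβ γ hγ hne
  simp only [dotProduct_add, dotProduct_smul, smul_eq_mul] at h1 h2
  by_cases hw : g (α, β, γ) = 0
  · refine ⟨((toReal α - toReal γ) ⬝ᵥ v) / ((toReal β - toReal γ) ⬝ᵥ v), ?_⟩
    have h3 : ((toReal β - toReal γ) ⬝ᵥ v) • (toReal α - toReal γ) =
      ((toReal α - toReal γ) ⬝ᵥ v) • (toReal β - toReal γ) := sub_eq_zero.1 hw
    rw [div_eq_inv_mul, mul_smul, ← h3, smul_smul, inv_mul_cancel₀ hb2, one_smul]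
  · exfalso
    have h3 : g (α, β, γ) ⬝ᵥ u ≠ 0 :=
      hu _ ⟨⟨(α, β, γ), by simp [hα, hβ, hγ], rfl⟩, hw⟩
    have h4 : g (α, β, γ) ⬝ᵥ u = ((toReal β - toReal γ) ⬝ᵥ v) * ((toReal α - toReal γ) ⬝ᵥ u) -
      ((toReal α - toReal γ) ⬝ᵥ v) * ((toReal β - toReal γ) ⬝ᵥ u) := by
      simp only [g]
      rw [sub_dotProduct, smul_dotProduct, smul_dotProduct, smul_eq_mul, smul_eq_mul]
    rw [h4] at h3
    generalize (toReal α - toReal γ) ⬝ᵥ v = a2 at *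
    generalize (toReal β - toReal γ) ⬝ᵥ v = b2 at *
    generalize (toReal α - toReal γ) ⬝ᵥ u = a1 at *
    generalize (toReal β - toReal γ) ⬝ᵥ u = b1 at *
    have hp : p = 0 := by
      have : p * (b2 * a1 - a2 * b1) = 0 := by linear_combination b2 * h1 - a2 * h2
      exact (mul_eq_zero.1 this).resolve_right h3
    have hq : q = 0 := by
      have : q * b2 = 0 := by rw [hp] at h2; linarith
      exact (mul_eq_zero.1 this).resolve_right hb2
    exact hpq.elim (fun h => h hp) (fun h => h hq)

/-! ### Edges, truncations and the shell -/

open Classical in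
lemma mem_periodicLift_coamoeba_truncation (f : LaurentPoly n) (Γ : Set (Fin n → ℝ))
    (θ : Fin n → ℝ) : θ ∈ periodicLift (coamoeba (truncation f Γ)) ↔
      ∃ y, expSum (f.coeff.support.filter fun α => toReal α ∈ Γ) f.coeff y θ = 0 := by
  rw [mem_periodicLift_coamoeba]
  refine exists_congr fun y => ?_
  have hs : (truncation f Γ).coeff.support = f.coeff.support.filter fun α => toReal α ∈ Γ :=
    Finsupp.support_filter _ _
  rw [hs]
  have : expSum (f.coeff.support.filter fun α => toReal α ∈ Γ) (truncation f Γ).coeff y θ =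
      expSum (f.coeff.support.filter fun α => toReal α ∈ Γ) f.coeff y θ := by
    refine Finset.sum_congr rfl fun α hα => ?_
    congr 1
    exact Finsupp.filter_apply_pos _ _ (Finset.mem_filter.1 hα).2
  rw [this]

lemma IsEdge.collinear {f : LaurentPoly n} {Γ : Set (Fin n → ℝ)} (hΓ : IsEdge f Γ)
    {a b c : Fin n → ℝ} (ha : a ∈ Γ) (hb : b ∈ Γ) (hc : c ∈ Γ) (hne : b ≠ c) :
    ∃ k : ℝ, a - c = k • (b - c) := by
  have h := exists_smul_eq_of_finrank_eq_one hΓ.2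
    (x := (⟨b - c, vsub_mem_vectorSpan ℝ hb hc⟩ : vectorSpan ℝ Γ))
    (by simpa [Subtype.ext_iff, sub_eq_zero] using hne) ⟨a - c, vsub_mem_vectorSpan ℝ ha hc⟩
  obtain ⟨k, hk⟩ := h
  exact ⟨k, by simpa using (congrArg Subtype.val hk).symm⟩

lemma periodicLift_shell_eq (f : LaurentPoly n) :
    periodicLift (shell f) = ⋃ Γ ∈ {Γ : Set (Fin n → ℝ) | IsEdge f Γ},
      periodicLift (coamoeba (truncation f Γ)) := by
  ext θ
  simp [periodicLift, shell]

/-- A truncation depends only on the exponents it keeps, so the union over edges is a finite union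
of closed sets. -/
lemma isClosed_periodicLift_shell (f : LaurentPoly n) : IsClosed (periodicLift (shell f)) := by
  classical
  rw [periodicLift_shell_eq]
  have h : (⋃ Γ ∈ {Γ : Set (Fin n → ℝ) | IsEdge f Γ}, periodicLift (coamoeba (truncation f Γ))) =
      ⋃ S ∈ {S ∈ (f.coeff.support.powerset : Set (Finset (Fin n → ℤ))) | ∃ Γ, IsEdge f Γ ∧
        S = f.coeff.support.filter fun α => toReal α ∈ Γ},
        {θ : Fin n → ℝ | ∃ y, expSum S f.coeff y θ = 0} := by
    ext θ
    simp only [Set.mem_iUnion, Set.mem_ofPred_eq, exists_prop, mem_periodicLift_coamoeba_truncation]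
    constructor
    · rintro ⟨Γ, h1, h2⟩
      exact ⟨_, ⟨Finset.mem_coe.2 (Finset.mem_powerset.2 (Finset.filter_subset _ _)), Γ, h1, rfl⟩, h2⟩
    · rintro ⟨_, ⟨-, Γ, h1, rfl⟩, h2⟩
      exact ⟨Γ, h1, h2⟩
  rw [h]
  refine ((Finset.finite_toSet _).subset (Set.sep_subset _ _)).isClosed_biUnion ?_
  rintro _ ⟨-, Γ, hΓ, rfl⟩
  refine isClosed_setOf_expSum_eq_zero (fun α hα => ?_) fun γ hγ α hα β hβ hne => ?_
  · exact Finsupp.mem_support_iff.1 (Finset.mem_filter.1 hα).1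
  · exact hΓ.collinear (Finset.mem_filter.1 hα).2 (Finset.mem_filter.1 hβ).2
      (Finset.mem_filter.1 hγ).2 (fun h => hne (toReal_injective h))

/-- If the exponents maximizing a functional are collinear but not a single point, they are the
exponents on an edge. -/
lemma exists_isEdge (f : LaurentPoly n) {e : Fin n → ℝ} {α₀ α₁ : Fin n → ℤ}
    (h0 : α₀ ∈ f.coeff.support) (hmax : ∀ α ∈ f.coeff.support, (toReal α - toReal α₀) ⬝ᵥ e ≤ 0)
    (h1 : α₁ ∈ f.coeff.support) (h1e : (toReal α₁ - toReal α₀) ⬝ᵥ e = 0) (hne : α₁ ≠ α₀)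
    (hcol : ∀ α ∈ f.coeff.support, (toReal α - toReal α₀) ⬝ᵥ e = 0 →
      ∃ k : ℝ, toReal α - toReal α₀ = k • (toReal α₁ - toReal α₀)) :
    ∃ Γ, IsEdge f Γ ∧ ∀ α ∈ f.coeff.support,
      (toReal α ∈ Γ ↔ (toReal α - toReal α₀) ⬝ᵥ e = 0) := by
  let l : StrongDual ℝ (Fin n → ℝ) := LinearMap.toContinuousLinearMap
    { toFun := fun x => x ⬝ᵥ e
      map_add' := fun x y => add_dotProduct x y e
      map_smul' := fun r x => smul_dotProduct r x e }
  have hl : ∀ x, l x = x ⬝ᵥ e := fun x => rfl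
  have hmem : ∀ α ∈ f.coeff.support, toReal α ∈ newtonPolytope f := fun α hα =>
    subset_convexHull ℝ _ ⟨α, hα, rfl⟩
  set d := toReal α₁ - toReal α₀ with hd
  have hsub : newtonPolytope f ⊆ {x | l x ≤ l (toReal α₀) ∧
      (l x = l (toReal α₀) → ∃ k : ℝ, x - toReal α₀ = k • d)} := by
    refine convexHull_min ?_ ?_
    · rintro _ ⟨α, hα, rfl⟩
      have h2 := hmax α hα
      rw [sub_dotProduct] at h2
      refine ⟨by rw [hl, hl]; linarith, fun h => hcol α hα ?_⟩
      rw [sub_dotProduct, ← hl, ← hl, h, sub_self]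
    · rintro x ⟨hx, hx'⟩ y ⟨hy, hy'⟩ s t hs ht hst
      have hlx : l (s • x + t • y) = s * l x + t * l y := by simp
      generalize hM : l (toReal α₀) = M at *
      have hMM : s * M + t * M = M := by rw [← add_mul, hst, one_mul]
      have hxM := mul_le_mul_of_nonneg_left hx hs
      have hyM := mul_le_mul_of_nonneg_left hy ht
      refine ⟨by rw [hlx]; linarith, fun h => ?_⟩
      rw [hlx] at h
      rcases hs.eq_or_lt with rfl | hs
      · obtain ⟨k, hk⟩ := hy' (by rw [zero_add] at hst; subst hst; linarith)
        rw [zero_add] at hst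
        exact ⟨k, by simp [hst, hk]⟩
      rcases ht.eq_or_lt with rfl | ht
      · obtain ⟨k, hk⟩ := hx' (by rw [add_zero] at hst; subst hst; linarith)
        rw [add_zero] at hst
        exact ⟨k, by simp [hst, hk]⟩
      -- With both weights positive, a convex combination attains the maximum only if both points
      -- do.
      obtain ⟨k, hk⟩ := hx' (by
        refine le_antisymm hx ?_
        by_contra hcon
        linarith [mul_lt_mul_of_pos_left (not_le.1 hcon) hs])
      obtain ⟨k', hk'⟩ := hy' (by
        refine le_antisymm hy ?_
        by_contra hcon
        linarith [mul_lt_mul_of_pos_left (not_le.1 hcon) ht])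
      refine ⟨s * k + t * k', ?_⟩
      have : s • x + t • y - toReal α₀ = s • (x - toReal α₀) + t • (y - toReal α₀) := by
        rw [smul_sub, smul_sub]
        have : toReal α₀ = s • toReal α₀ + t • toReal α₀ := by rw [← add_smul, hst, one_smul]
        nth_rewrite 1 [this]
        abel
      rw [this, hk, hk', add_smul, mul_smul, mul_smul]
  have hΓ : ∀ x, x ∈ l.toExposed (newtonPolytope f) ↔
      x ∈ newtonPolytope f ∧ l x = l (toReal α₀) := fun x => by
    refine ⟨fun hx => ⟨hx.1, le_antisymm (hsub hx.1).1 (hx.2 _ (hmem α₀ h0))⟩,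
      fun hx => ⟨hx.1, fun y hy => hx.2 ▸ (hsub hy).1⟩⟩
  refine ⟨l.toExposed (newtonPolytope f), ⟨ContinuousLinearMap.toExposed.isExposed, ?_⟩, fun α hα => ?_⟩
  · have h0Γ : toReal α₀ ∈ l.toExposed (newtonPolytope f) := (hΓ _).2 ⟨hmem _ h0, rfl⟩
    have h1Γ : toReal α₁ ∈ l.toExposed (newtonPolytope f) := (hΓ _).2 ⟨hmem _ h1, by
      rw [hl, hl, ← sub_eq_zero, ← sub_dotProduct, h1e]⟩
    have hdne : d ≠ 0 := fun h => hne (toReal_injective (sub_eq_zero.1 h))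
    have hspan : vectorSpan ℝ (l.toExposed (newtonPolytope f)) = Submodule.span ℝ {d} := by
      apply le_antisymm
      · rw [vectorSpan_eq_span_vsub_set_right ℝ h0Γ, Submodule.span_le]
        rintro _ ⟨x, hx, rfl⟩
        obtain ⟨k, hk⟩ := (hsub ((hΓ x).1 hx).1).2 ((hΓ x).1 hx).2
        exact Submodule.mem_span_singleton.2 ⟨k, hk.symm⟩
      · rw [Submodule.span_le, Set.singleton_subset_iff]
        exact vsub_mem_vectorSpan ℝ h1Γ h0Γ
    rw [hspan, finrank_span_singleton hdne]
  · rw [hΓ, hl, hl, sub_dotProduct, sub_eq_zero]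
    exact ⟨fun h => h.2, fun h => ⟨hmem α hα, h⟩⟩

/-! ### Compactness of the zeros over a segment -/

/-- The zeros of `f` with logarithmic absolute values in the plane `x₀ + ⟨u, v⟩` and arguments in
the segment from `a` to `a + v`, by their coordinates. -/
def zeroStrip (f : LaurentPoly n) (x₀ u v a : Fin n → ℝ) : Set (ℝ × ℝ × ℝ) :=
  {p | p.2.2 ∈ Set.Icc (0 : ℝ) 1 ∧
    expSum f.coeff.support f.coeff (x₀ + p.1 • u + p.2.1 • v) (a + p.2.2 • v) = 0}

lemma isClosed_zeroStrip (f : LaurentPoly n) (x₀ u v a : Fin n → ℝ) :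
    IsClosed (zeroStrip f x₀ u v a) := by
  refine IsClosed.inter (isClosed_Icc.preimage (by fun_prop)) ?_
  refine isClosed_eq ?_ continuous_const
  exact (continuous_expSum _ _).comp
    (f := fun p : ℝ × ℝ × ℝ => (x₀ + p.1 • u + p.2.1 • v, a + p.2.2 • v)) (by fun_prop)

/-- An unbounded family of zeros has a limiting direction `w ≠ 0` in the plane of `u` and `v`. The
surviving terms maximize `w`, and genericity places them on an edge whose coamoeba contains a point
of the segment. -/
lemma isBounded_zeroStrip {f : LaurentPoly n} (hf : f.coeff.support.Nonempty)
    {x₀ u v a : Fin n → ℝ} (hgen : GenericPlane f.coeff.support u v)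
    (hshell : ∀ t ∈ Set.Icc (0 : ℝ) 1, a + t • v ∉ periodicLift (shell f)) :
    Bornology.IsBounded (zeroStrip f x₀ u v a) := by
  classical
  by_contra hbd
  have hne : (Bornology.cobounded (ℝ × ℝ × ℝ) ⊓ 𝓟 (zeroStrip f x₀ u v a)).NeBot := by
    rw [← Filter.frequently_mem_iff_neBot]
    intro h
    exact hbd (Bornology.isBounded_def.2 h)
  set U := Ultrafilter.of (Bornology.cobounded (ℝ × ℝ × ℝ) ⊓ 𝓟 (zeroStrip f x₀ u v a)) with hU
  have hle := Ultrafilter.of_le (Bornology.cobounded (ℝ × ℝ × ℝ) ⊓ 𝓟 (zeroStrip f x₀ u v a))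
  rw [← hU] at hle
  have hZ : ∀ᶠ p in U, p ∈ zeroStrip f x₀ u v a := le_principal_iff.1 (hle.trans inf_le_right)
  have hnorm : Tendsto (fun p : ℝ × ℝ × ℝ => ‖p‖) U atTop :=
    tendsto_norm_cobounded_atTop.mono_left (hle.trans inf_le_left)
  -- the arguments converge
  obtain ⟨t₀, ht₀, ht⟩ := (isCompact_Icc (a := (0 : ℝ)) (b := 1)).ultrafilter_le_nhds
    (U.map fun p => p.2.2) (by
      rw [le_principal_iff]
      exact hZ.mono fun p hp => hp.1)
  replace ht : Tendsto (fun p : ℝ × ℝ × ℝ => p.2.2) U (𝓝 t₀) := ht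
  -- the directions converge
  obtain ⟨e, he, hlim⟩ := (isCompact_sphere (0 : ℝ × ℝ × ℝ) 1).ultrafilter_le_nhds
    (U.map fun p => ‖p‖⁻¹ • p) (by
      rw [le_principal_iff]
      change ∀ᶠ p in (U : Filter (ℝ × ℝ × ℝ)), _
      filter_upwards [hnorm.eventually_gt_atTop 0] with p hp
      rw [mem_sphere_zero_iff_norm, norm_smul, norm_inv, norm_norm, inv_mul_cancel₀ hp.ne'])
  replace hlim : Tendsto (fun p : ℝ × ℝ × ℝ => ‖p‖⁻¹ • p) U (𝓝 e) := hlim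
  have hinv : Tendsto (fun p : ℝ × ℝ × ℝ => ‖p‖⁻¹) U (𝓝 0) := tendsto_inv_atTop_zero.comp hnorm
  -- The argument parameter stays in `[0, 1]`, so the escape is entirely in the logarithmic
  -- coordinates.
  have he3 : e.2.2 = 0 := by
    refine tendsto_nhds_unique (((continuous_snd.comp continuous_snd).tendsto e).comp hlim) ?_
    have h := hinv.mul ht
    rw [zero_mul] at h
    exact h
  have he12 : e.1 ≠ 0 ∨ e.2.1 ≠ 0 := by
    by_contra h
    push Not at h
    have : e = 0 := Prod.ext h.1 (Prod.ext h.2 he3)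
    rw [this] at he
    simp at he
  set w : Fin n → ℝ := e.1 • u + e.2.1 • v with hw
  have hdir : Tendsto (fun p : ℝ × ℝ × ℝ => ‖p‖⁻¹ • (x₀ + p.1 • u + p.2.1 • v)) U (𝓝 w) := by
    have h1 : Tendsto (fun p : ℝ × ℝ × ℝ => ‖p‖⁻¹ • x₀ + (‖p‖⁻¹ * p.1) • u + (‖p‖⁻¹ * p.2.1) • v) U
        (𝓝 ((0 : ℝ) • x₀ + e.1 • u + e.2.1 • v)) := by
      refine ((hinv.smul_const x₀).add (Tendsto.smul_const ?_ u)).add (Tendsto.smul_const ?_ v)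
      · exact (continuous_fst.tendsto e).comp hlim
      · exact ((continuous_fst.comp continuous_snd).tendsto e).comp hlim
    rw [zero_smul, zero_add] at h1
    refine h1.congr fun p => ?_
    rw [smul_add, smul_add, smul_smul, smul_smul]
  have hθ : Tendsto (fun p : ℝ × ℝ × ℝ => a + p.2.2 • v) U (𝓝 (a + t₀ • v)) :=
    tendsto_const_nhds.add (ht.smul_const v)
  obtain ⟨α₀, h0, ρ, hρ, hρ0, hmax, hsum⟩ := exists_dominant_limit U hf f.coeff
    (fun p => x₀ + p.1 • u + p.2.1 • v) (fun p => a + p.2.2 • v) _ (hZ.mono fun p hp => hp.2) hθ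
  have hdot : ∀ α : Fin n → ℤ, Tendsto (fun p : ℝ × ℝ × ℝ =>
      ‖p‖⁻¹ * ((toReal α - toReal α₀) ⬝ᵥ (x₀ + p.1 • u + p.2.1 • v))) U
      (𝓝 ((toReal α - toReal α₀) ⬝ᵥ w)) := fun α => by
    have hc : Continuous fun x : Fin n → ℝ => (toReal α - toReal α₀) ⬝ᵥ x := by
      unfold dotProduct
      fun_prop
    refine ((hc.tendsto w).comp hdir).congr fun p => ?_
    simp only [Function.comp_apply, dotProduct_smul, smul_eq_mul]
  have hwmax : ∀ α ∈ f.coeff.support, (toReal α - toReal α₀) ⬝ᵥ w ≤ 0 := fun α hα => by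
    refine le_of_tendsto (hdot α) ?_
    filter_upwards [hmax] with p hp
    exact mul_nonpos_of_nonneg_of_nonpos (inv_nonneg.2 (norm_nonneg p)) (hp α hα)
  -- A nonzero limit `ρ α` keeps the exponent's pairing bounded, so dividing by the norm gives `0`.
  have hwzero : ∀ α ∈ f.coeff.support, ρ α ≠ 0 → (toReal α - toReal α₀) ⬝ᵥ w = 0 :=
    fun α hα hne => by
    have h1 := (Real.continuousAt_log hne).tendsto.comp (hρ α hα)
    simp only [Function.comp_def, Real.log_exp] at h1
    refine tendsto_nhds_unique (hdot α) ?_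
    simpa using hinv.mul h1
  obtain ⟨⟨α₁, h1, hne1⟩, y', hy'⟩ := exists_zero_of_collinear U
    (S := f.coeff.support.filter fun α => (toReal α - toReal α₀) ⬝ᵥ w = 0)
    (fun α hα => Finsupp.mem_support_iff.1 hα) h0 hρ hρ0 hsum
    (Finset.filter_subset _ _) (fun α hα hne => Finset.mem_filter.2 ⟨hα, hwzero α hα hne⟩)
    (fun α hα β hβ hne => hgen α (Finset.mem_filter.1 hα).1 β (Finset.mem_filter.1 hβ).1 α₀ h0 hne
      _ _ he12 (Finset.mem_filter.1 hα).2 (Finset.mem_filter.1 hβ).2)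
  obtain ⟨h1f, h1w⟩ := Finset.mem_filter.1 h1
  obtain ⟨Γ, hΓ, hmem⟩ := exists_isEdge f h0 hwmax h1f h1w hne1
    (fun α hα hαw => hgen α hα α₁ h1f α₀ h0 hne1 _ _ he12 hαw h1w)
  refine hshell t₀ ht₀ ?_
  rw [periodicLift_shell_eq]
  refine Set.mem_biUnion (x := Γ) hΓ ?_
  rw [mem_periodicLift_coamoeba_truncation]
  refine ⟨y', ?_⟩
  rw [← hy', Finset.filter_congr hmem]

lemma isCompact_zeroStrip {f : LaurentPoly n} (hf : f.coeff.support.Nonempty)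
    {x₀ u v a : Fin n → ℝ} (hgen : GenericPlane f.coeff.support u v)
    (hshell : ∀ t ∈ Set.Icc (0 : ℝ) 1, a + t • v ∉ periodicLift (shell f)) :
    IsCompact (zeroStrip f x₀ u v a) :=
  Metric.isCompact_of_isClosed_isBounded (isClosed_zeroStrip f x₀ u v a)
    (isBounded_zeroStrip hf hgen hshell)

/-! ### Persistence of zeros and the extremal argument -/

/-- Zeros of a family of entire functions persist under small changes of the parameter. -/
lemma eventually_exists_zero {F : ℝ → ℂ → ℂ} (hF : Continuous fun p : ℝ × ℂ => F p.1 p.2)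
    (hd : ∀ μ, Differentiable ℂ (F μ)) {μ₀ : ℝ} {w₀ : ℂ} (h0 : F μ₀ w₀ = 0)
    (hne : ∃ w, F μ₀ w ≠ 0) {O : Set ℂ} (hO : O ∈ 𝓝 w₀) :
    ∀ᶠ μ in 𝓝 μ₀, ∃ w ∈ O, F μ w = 0 := by
  have han : ∀ μ, AnalyticOnNhd ℂ (F μ) Set.univ := fun μ z _ => (hd μ).analyticAt z
  have hiso : ∀ᶠ z in 𝓝[≠] w₀, F μ₀ z ≠ 0 := by
    refine ((hd μ₀).analyticAt w₀).eventually_eq_zero_or_eventually_ne_zero.resolve_left fun h => ?_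
    obtain ⟨w, hw⟩ := hne
    have := AnalyticOnNhd.eq_of_eventuallyEq (han μ₀)
      (fun z _ => analyticAt_const (v := (0 : ℂ))) (z₀ := w₀) h
    exact hw (congrFun this w)
  have h1 : ∀ᶠ z in 𝓝 w₀, z ∈ O ∧ (z ≠ w₀ → F μ₀ z ≠ 0) :=
    Filter.Eventually.and hO (eventually_nhdsWithin_iff.1 hiso)
  obtain ⟨r, hr, hball⟩ := Metric.nhds_basis_closedBall.eventually_iff.1 h1
  have hsph : ∀ z ∈ Metric.sphere w₀ r, F μ₀ z ≠ 0 := fun z hz =>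
    (hball (Metric.sphere_subset_closedBall hz)).2 (by
      rintro rfl
      simp at hz
      exact hr.ne hz)
  have hcμ : Continuous (F μ₀) := (hd μ₀).continuous
  obtain ⟨z₁, hz₁, hmin⟩ := (isCompact_sphere w₀ r).exists_isMinOn
    (NormedSpace.sphere_nonempty.2 hr.le) (f := fun z => ‖F μ₀ z‖) (by fun_prop)
  set δ := ‖F μ₀ z₁‖ with hδ
  have hδpos : 0 < δ := norm_pos_iff.2 (hsph z₁ hz₁)
  have hA : ∀ᶠ μ in 𝓝 μ₀, ∀ z ∈ Metric.sphere w₀ r, 3 / 4 * δ < ‖F μ z‖ := by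
    refine (isCompact_sphere w₀ r).eventually_forall_of_forall_eventually fun z hz => ?_
    refine (hF.norm.tendsto (μ₀, z)).eventually_const_lt ?_
    have : δ ≤ ‖F μ₀ z‖ := hmin hz
    change 3 / 4 * δ < ‖F μ₀ z‖
    linarith
  have hB : ∀ᶠ μ in 𝓝 μ₀, ‖F μ w₀‖ < δ / 4 := by
    have : Continuous fun μ => ‖F μ w₀‖ :=
      (hF.comp (Continuous.prodMk continuous_id continuous_const)).norm
    refine (this.tendsto μ₀).eventually_lt_const ?_
    rw [h0, norm_zero]
    linarith
  filter_upwards [hA, hB] with μ hμA hμB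
  -- The quantitative open mapping theorem turns this separation into an image containing the ball
  -- of radius `δ / 4` about `F μ w₀`, which contains `0`.
  have hsep : ∀ z ∈ Metric.sphere w₀ r, δ / 2 ≤ ‖F μ z - F μ w₀‖ := fun z hz => by
    linarith [hμA z hz, norm_sub_norm_le (F μ z) (F μ w₀)]
  have hfreq : ∃ᶠ z in 𝓝 w₀, F μ z ≠ F μ w₀ := by
    intro h
    have h2 := AnalyticOnNhd.eq_of_eventuallyEq (han μ)
      (fun z _ => analyticAt_const (v := F μ w₀)) (z₀ := w₀)
      (h.mono fun z hz => not_not.1 hz)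
    have h3 := hsep z₁ hz₁
    rw [congrFun h2 z₁, sub_self, norm_zero] at h3
    linarith
  have hsub := ((hd μ).diffContOnCl (s := Metric.ball w₀ r)).ball_subset_image_closedBall
    hr hsep hfreq
  obtain ⟨w, hw, hw0⟩ := hsub (show (0 : ℂ) ∈ Metric.ball (F μ w₀) (δ / 2 / 2) by
    rw [mem_ball_iff_norm, zero_sub, norm_neg]
    linarith)
  exact ⟨w, (hball hw).1, hw0⟩

/-- In a separating direction, a segment that avoids the shell and whose endpoints avoid the
coamoeba avoids the coamoeba. -/
lemma segment_avoids_coamoeba_of_separates {f : LaurentPoly n} (hf : f.coeff.support.Nonempty)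
    {a v : Fin n → ℝ} (hv : Separates f.coeff.support v)
    (hshell : ∀ t ∈ Set.Icc (0 : ℝ) 1, a + t • v ∉ periodicLift (shell f))
    (ha : a ∉ periodicLift (coamoeba f)) (hb : a + v ∉ periodicLift (coamoeba f)) :
    ∀ t ∈ Set.Icc (0 : ℝ) 1, a + t • v ∉ periodicLift (coamoeba f) := by
  intro t₀ ht₀ hmem
  obtain ⟨x₀, hx₀⟩ := (mem_periodicLift_coamoeba f _).1 hmem
  obtain ⟨u, hgen⟩ := exists_genericPlane hv
  have hcomp : IsCompact (zeroStrip f x₀ u v a) := isCompact_zeroStrip hf hgen hshell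
  obtain ⟨⟨l, s, t⟩, hp, hmax⟩ := hcomp.exists_isMaxOn
    (⟨(0, 0, t₀), ht₀, by simpa using hx₀⟩ : (zeroStrip f x₀ u v a).Nonempty)
    (f := Prod.fst) continuous_fst.continuousOn
  obtain ⟨⟨ht0, ht1⟩, hzero⟩ := hp
  simp only at ht0 ht1 hzero
  -- Moving logarithms and arguments in the same direction `v` makes `w = s + it` a holomorphic
  -- coordinate.
  let F : ℝ → ℂ → ℂ := fun μ w => ∑ α ∈ f.coeff.support, f.coeff α *
    Complex.exp (((toReal α ⬝ᵥ (x₀ + μ • u) : ℝ) + (toReal α ⬝ᵥ a : ℝ) * I) +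
      (toReal α ⬝ᵥ v : ℝ) * w)
  have hFeq : ∀ μ w, F μ w =
      expSum f.coeff.support f.coeff (x₀ + μ • u + w.re • v) (a + w.im • v) := fun μ w => by
    refine Finset.sum_congr rfl fun α _ => ?_
    congr 2
    simp only [dotProduct_add, dotProduct_smul, smul_eq_mul]
    nth_rewrite 1 [← Complex.re_add_im w]
    push_cast
    ring
  have hFc : Continuous fun p : ℝ × ℂ => F p.1 p.2 := by
    simp only [F, dotProduct]
    fun_prop
  have hFd : ∀ μ, Differentiable ℂ (F μ) := fun μ => by
    simp only [F]
    fun_prop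
  have hF0 : F l (s + t * I) = 0 := by
    rw [hFeq, ← hzero]
    simp
  -- Otherwise a whole line, with `s` arbitrary, would lie in the compact set of zeros.
  have hFne : ∃ w, F l w ≠ 0 := by
    by_contra hcon
    push Not at hcon
    obtain ⟨R, hR⟩ := hcomp.isBounded.exists_norm_le
    have h1 : ‖((l, |R| + 1, t) : ℝ × ℝ × ℝ)‖ ≤ R := hR _ ⟨⟨ht0, ht1⟩, by
      have := hcon ((|R| + 1 : ℝ) + t * I)
      rw [hFeq] at this
      simpa using this⟩
    have h2 : ‖|R| + 1‖ ≤ R := (le_max_left _ _).trans ((le_max_right _ _).trans h1)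
    rw [Real.norm_of_nonneg (by positivity)] at h2
    linarith [le_abs_self R]
  have htpos : 0 < t := by
    refine lt_of_le_of_ne ht0 fun h => ha ?_
    rw [mem_periodicLift_coamoeba]
    exact ⟨_, by simpa [← h] using hzero⟩
  have htlt : t < 1 := by
    refine lt_of_le_of_ne ht1 fun h => hb ?_
    rw [mem_periodicLift_coamoeba]
    exact ⟨_, by simpa [h] using hzero⟩
  have hO : {w : ℂ | 0 < w.im ∧ w.im < 1} ∈ 𝓝 ((s : ℂ) + t * I) := by
    refine IsOpen.mem_nhds ?_ (by simp [htpos, htlt])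
    exact (isOpen_lt continuous_const Complex.continuous_im).inter
      (isOpen_lt Complex.continuous_im continuous_const)
  obtain ⟨μ, ⟨w, hw, hw0⟩, hμ⟩ := (((eventually_exists_zero hFc hFd hF0 hFne hO).filter_mono
    (nhdsWithin_le_nhds (s := Set.Ioi l))).and self_mem_nhdsWithin).exists
  have h3 : (μ, w.re, w.im) ∈ zeroStrip f x₀ u v a := ⟨⟨hw.1.le, hw.2.le⟩, by
    rw [← hw0, hFeq]⟩
  have h4 : μ ≤ l := hmax h3
  exact absurd hμ (not_lt.2 h4)

/-- A segment that avoids the shell and whose endpoints avoid the closed coamoeba avoids the closed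
coamoeba. -/
lemma segment_avoids_closure_coamoeba {f : LaurentPoly n} {a b : Fin n → ℝ}
    (ha : a ∉ closure (periodicLift (coamoeba f))) (hb : b ∉ closure (periodicLift (coamoeba f)))
    (hshell : ∀ t ∈ Set.Icc (0 : ℝ) 1, a + t • (b - a) ∉ periodicLift (shell f)) :
    ∀ t ∈ Set.Icc (0 : ℝ) 1, a + t • (b - a) ∉ closure (periodicLift (coamoeba f)) := by
  intro t₀ ht₀ hmem
  -- The zero polynomial has the whole space as coamoeba.
  have hf : f.coeff.support.Nonempty := by
    rw [Finset.nonempty_iff_ne_empty]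
    intro h
    refine ha (subset_closure ?_)
    rw [mem_periodicLift_coamoeba, h]
    exact ⟨0, rfl⟩
  -- Parametrized to pass through `q.1` at time `t₀`, so the base point can be moved into the
  -- coamoeba independently of the direction.
  let Φ : (Fin n → ℝ) × (Fin n → ℝ) → ℝ → Fin n → ℝ := fun q t => q.1 + (t - t₀) • q.2
  have hΦ : Continuous fun r : ((Fin n → ℝ) × (Fin n → ℝ)) × ℝ => Φ r.1 r.2 := by
    simp only [Φ]
    fun_prop
  set p := a + t₀ • (b - a) with hp
  have hΦp : ∀ t, Φ (p, b - a) t = a + t • (b - a) := fun t => by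
    simp only [Φ, hp, sub_smul]
    abel
  have h1 : ∀ᶠ q in 𝓝 (p, b - a), ∀ t ∈ Set.Icc (0 : ℝ) 1, Φ q t ∉ periodicLift (shell f) := by
    refine isCompact_Icc.eventually_forall_of_forall_eventually fun t ht => ?_
    refine (hΦ.tendsto ((p, b - a), t)).eventually
      ((isClosed_periodicLift_shell f).isOpen_compl.mem_nhds ?_)
    rw [hΦp]
    exact hshell t ht
  have h2 : ∀ t, a + t • (b - a) ∉ closure (periodicLift (coamoeba f)) →
      ∀ᶠ q in 𝓝 (p, b - a), Φ q t ∉ closure (periodicLift (coamoeba f)) := fun t ht => by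
    have hc : Continuous fun q => Φ q t := hΦ.comp (Continuous.prodMk continuous_id continuous_const)
    refine (hc.tendsto (p, b - a)).eventually (isClosed_closure.isOpen_compl.mem_nhds ?_)
    rw [hΦp]
    exact ht
  have hev := h1.and ((h2 0 (by simpa using ha)).and (h2 1 (by simpa using hb)))
  have hcl : (p, b - a) ∈ closure
      (periodicLift (coamoeba f) ×ˢ {v | Separates f.coeff.support v}) := by
    rw [closure_prod_eq, (dense_separates _).closure_eq]
    exact ⟨hmem, trivial⟩
  obtain ⟨⟨k, v⟩, ⟨hsh, hka, hkb⟩, hk, hv⟩ := mem_closure_iff_nhds.1 hcl _ hev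
  have hline : ∀ t, Φ (k, v) 0 + t • v = Φ (k, v) t := fun t => by
    simp only [Φ, sub_smul]
    abel_nf
    simp
  refine segment_avoids_coamoeba_of_separates hf (a := Φ (k, v) 0) hv
    (fun t ht => by rw [hline]; exact hsh t ht) (fun h => hka (subset_closure h))
    (fun h => hkb (subset_closure ?_)) t₀ ht₀ ?_
  · rw [← hline, one_smul]
    exact h
  · rw [hline]
    simpa [Φ] using hk

/-! ### Convexity of cells -/

/-- Edge coamoebas are unions of parallel hyperplanes. -/
lemma IsEdge.exists_normal {f : LaurentPoly n} {Γ : Set (Fin n → ℝ)} (hΓ : IsEdge f Γ) :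
    ∃ d : Fin n → ℝ, ∀ θ θ' : Fin n → ℝ, d ⬝ᵥ θ = d ⬝ᵥ θ' →
      θ ∈ periodicLift (coamoeba (truncation f Γ)) →
      θ' ∈ periodicLift (coamoeba (truncation f Γ)) := by
  classical
  obtain ⟨⟨d, hd⟩, -, hspan⟩ := finrank_eq_one_iff'.1 hΓ.2
  refine ⟨d, fun θ θ' h => ?_⟩
  simp only [mem_periodicLift_coamoeba_truncation]
  rintro ⟨y, hy⟩
  refine ⟨y, ?_⟩
  rcases (f.coeff.support.filter fun α => toReal α ∈ Γ).eq_empty_or_nonempty with hS | ⟨α₀, h0⟩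
  · rw [hS]
    rfl
  -- Exponents on the edge differ by multiples of `d`, so the shift multiplies all terms by one
  -- common phase.
  have h2 : expSum (f.coeff.support.filter fun α => toReal α ∈ Γ) f.coeff y θ' =
      expSum (f.coeff.support.filter fun α => toReal α ∈ Γ) f.coeff y θ *
        Complex.exp ((toReal α₀ ⬝ᵥ (θ' - θ) : ℝ) * I) := by
    unfold expSum
    rw [Finset.sum_mul]
    refine Finset.sum_congr rfl fun α hα => ?_
    rw [mul_assoc, ← Complex.exp_add]
    congr 2
    obtain ⟨k, hk⟩ := hspan ⟨toReal α - toReal α₀,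
      vsub_mem_vectorSpan ℝ (Finset.mem_filter.1 hα).2 (Finset.mem_filter.1 h0).2⟩
    have hk' : toReal α - toReal α₀ = k • d := by simpa using (congrArg Subtype.val hk).symm
    have h3 : (toReal α - toReal α₀) ⬝ᵥ (θ' - θ) = 0 := by
      rw [hk', smul_dotProduct, dotProduct_sub, h, sub_self, smul_zero]
    rw [sub_dotProduct, dotProduct_sub (toReal α)] at h3
    have h4 : toReal α ⬝ᵥ θ' = toReal α ⬝ᵥ θ + toReal α₀ ⬝ᵥ (θ' - θ) := by linarith
    rw [h4]
    push_cast
    ring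
  rw [h2, hy, zero_mul]

/-- Cells of the shell are convex. -/
lemma IsPreconnected.segment_avoids_shell {f : LaurentPoly n} {C : Set (Fin n → ℝ)}
    (hC : IsPreconnected C) (hsub : C ⊆ (periodicLift (shell f))ᶜ) {x y : Fin n → ℝ}
    (hx : x ∈ C) (hy : y ∈ C) :
    ∀ t ∈ Set.Icc (0 : ℝ) 1, x + t • (y - x) ∉ periodicLift (shell f) := by
  intro t ht hmem
  rw [periodicLift_shell_eq] at hmem
  obtain ⟨Γ, hΓ, hp⟩ := Set.mem_iUnion₂.1 hmem
  obtain ⟨d, hd⟩ := IsEdge.exists_normal hΓ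
  have hc : Continuous fun x : Fin n → ℝ => d ⬝ᵥ x := by
    unfold dotProduct
    fun_prop
  -- The image of `C` under `d` is an interval, so a hyperplane normal to `d` meeting the segment
  -- also meets `C`.
  have hconv : Convex ℝ _ := (hC.image _ hc.continuousOn).ordConnected.convex
  obtain ⟨c, hcC, hcd⟩ := hconv.add_smul_sub_mem (Set.mem_image_of_mem _ hx)
    (Set.mem_image_of_mem _ hy) ht
  refine hsub hcC ?_
  rw [periodicLift_shell_eq]
  refine Set.mem_biUnion hΓ (hd _ c ?_ hp)
  simp only [dotProduct_add, dotProduct_smul, dotProduct_sub]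
  exact hcd.symm

lemma exists_mem_segment_shell {f : LaurentPoly n} {a b : Fin n → ℝ}
    (ha : a ∉ closure (periodicLift (coamoeba f))) (hb : b ∉ closure (periodicLift (coamoeba f)))
    (h : (segment ℝ a b ∩ closure (periodicLift (coamoeba f))).Nonempty) :
    ∃ Γ, IsEdge f Γ ∧ (segment ℝ a b ∩ periodicLift (coamoeba (truncation f Γ))).Nonempty := by
  obtain ⟨p, hp, hpc⟩ := h
  by_contra hcon
  push Not at hcon
  rw [segment_eq_image'] at hp hcon
  obtain ⟨t, ht, rfl⟩ := hp
  refine segment_avoids_closure_coamoeba ha hb (fun s hs hmem => ?_) t ht hpc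
  rw [periodicLift_shell_eq] at hmem
  obtain ⟨Γ, hΓ, hmem⟩ := Set.mem_iUnion₂.1 hmem
  exact (hcon Γ hΓ).subset ⟨⟨s, hs, rfl⟩, hmem⟩

/-- If points of the same cell of the shell lie off the closed coamoeba, so does the segment
between them. -/
lemma IsPreconnected.segment_subset_compl_closure {f : LaurentPoly n} {C : Set (Fin n → ℝ)}
    (hC : IsPreconnected C) (hsub : C ⊆ (periodicLift (shell f))ᶜ) {x y : Fin n → ℝ}
    (hx : x ∈ C) (hy : y ∈ C) (hx' : x ∉ closure (periodicLift (coamoeba f)))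
    (hy' : y ∉ closure (periodicLift (coamoeba f))) :
    segment ℝ x y ⊆ (closure (periodicLift (coamoeba f)))ᶜ := by
  rw [segment_eq_image']
  rintro _ ⟨t, ht, rfl⟩
  exact segment_avoids_closure_coamoeba hx' hy'
    (IsPreconnected.segment_avoids_shell hC hsub hx hy) t ht

lemma subsingleton_complComponents {X : Type*} [TopologicalSpace X] {S C : Set X}
    (h : ∀ x ∈ C, ∀ y ∈ C, x ∉ S → y ∉ S → y ∈ connectedComponentIn Sᶜ x) :
    {Θ ∈ complComponents S | Θ ⊆ C}.Subsingleton := by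
  rintro _ ⟨⟨x, hx, rfl⟩, hxC⟩ _ ⟨⟨y, hy, rfl⟩, hyC⟩
  exact connectedComponentIn_eq
    (h x (hxC (mem_connectedComponentIn hx)) y (hyC (mem_connectedComponentIn hy)) hx hy)

/-! ### Passage to the torus -/

/-- The projection `ℝ^n → T^n`. -/
def proj (θ : Fin n → ℝ) : Torus n := fun i => (θ i : Real.Angle)

lemma continuous_proj : Continuous (proj : (Fin n → ℝ) → Torus n) :=
  continuous_pi fun i => Real.Angle.continuous_coe.comp (continuous_apply i)

lemma isOpenMap_proj : IsOpenMap (proj : (Fin n → ℝ) → Torus n) :=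
  IsOpenMap.piMap (fun _ => QuotientAddGroup.isOpenMap_coe)
    (Eventually.of_forall fun _ => QuotientAddGroup.mk_surjective)

lemma surjective_proj : Function.Surjective (proj : (Fin n → ℝ) → Torus n) :=
  Function.Surjective.piMap fun _ => QuotientAddGroup.mk_surjective

lemma periodicLift_closure (S : Set (Torus n)) :
    periodicLift (closure S) = closure (periodicLift S) :=
  isOpenMap_proj.preimage_closure_eq_closure_preimage continuous_proj S

instance : LocallyPathConnectedSpace (Torus n) :=
  (isOpenMap_proj.isQuotientMap continuous_proj surjective_proj).locallyPathConnectedSpace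

lemma isClosed_shell (f : LaurentPoly n) : IsClosed (shell f) :=
  (isOpenMap_proj.isQuotientMap continuous_proj surjective_proj).isClosed_preimage.1
    (isClosed_periodicLift_shell f)

lemma exists_lift_path (γ : C(unitInterval, Torus n)) :
    ∃ Γ : C(unitInterval, Fin n → ℝ), ∀ t, proj (Γ t) = γ t := by
  have hcov : IsCoveringMap ((↑) : ℝ → Real.Angle) := AddCircle.isCoveringMap_coe (2 * Real.pi)
  have h : ∀ i, ∃ Γ : C(unitInterval, ℝ), ∀ t, ((Γ t : ℝ) : Real.Angle) = γ t i := fun i => by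
    obtain ⟨e, he⟩ := QuotientAddGroup.mk_surjective (γ 0 i)
    obtain ⟨Γ, hΓ, -⟩ := hcov.exists_path_lifts
      ⟨fun t => γ t i, (continuous_apply i).comp γ.continuous⟩ e he.symm
    exact ⟨Γ, fun t => congrFun hΓ t⟩
  choose Γ hΓ using h
  exact ⟨⟨fun t i => Γ i t, by fun_prop⟩, fun t => funext fun i => hΓ i t⟩

/-- Points of the torus in the same cell of the shell and off the closed coamoeba are in the same
component of the complement of the closed coamoeba. -/
lemma mem_connectedComponentIn_of_cell {f : LaurentPoly n} {c x y : Torus n}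
    (hx : x ∈ connectedComponentIn (shell f)ᶜ c) (hy : y ∈ connectedComponentIn (shell f)ᶜ c)
    (hx' : x ∉ closure (coamoeba f)) (hy' : y ∉ closure (coamoeba f)) :
    y ∈ connectedComponentIn (closure (coamoeba f))ᶜ x := by
  have hopen : IsOpen (connectedComponentIn (shell f)ᶜ c) :=
    (isClosed_shell f).isOpen_compl.connectedComponentIn
  have hpath := hopen.isConnected_iff_isPathConnected.1
    ⟨⟨x, hx⟩, isPreconnected_connectedComponentIn⟩
  obtain ⟨γ, hγ⟩ := hpath.joinedIn x hx y hy
  obtain ⟨Γ, hΓ⟩ := exists_lift_path γ.toContinuousMap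
  have hsub : Set.range Γ ⊆ (periodicLift (shell f))ᶜ := by
    rintro _ ⟨t, rfl⟩ hmem
    have h1 : proj (Γ t) ∈ shell f := hmem
    rw [hΓ] at h1
    exact connectedComponentIn_subset _ _ (hγ t) h1
  have h0 : proj (Γ 0) = x := (hΓ 0).trans γ.source
  have h1 : proj (Γ 1) = y := (hΓ 1).trans γ.target
  -- The lifted path is a connected set off the shell, which is all the convexity argument needs.
  have hseg := IsPreconnected.segment_subset_compl_closure
    (isPreconnected_range Γ.continuous) hsub ⟨0, rfl⟩ ⟨1, rfl⟩
    (by rw [← periodicLift_closure]; exact fun h => hx' (h0 ▸ h))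
    (by rw [← periodicLift_closure]; exact fun h => hy' (h1 ▸ h))
  rw [← periodicLift_closure] at hseg
  have hpre : IsPreconnected (proj '' segment ℝ (Γ 0) (Γ 1)) :=
    (convex_segment (𝕜 := ℝ) _ _).isPreconnected.image _ continuous_proj.continuousOn
  refine hpre.subset_connectedComponentIn ⟨_, left_mem_segment ℝ _ _, h0⟩ ?_
    ⟨_, right_mem_segment ℝ _ _, h1⟩
  rintro _ ⟨p, hp, rfl⟩
  exact hseg hp

end Coamoeba

end

theorem lemma2p3 {n : ℕ} (f : Coamoeba.LaurentPoly n) :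
    -- segments in `ℝ^n`
    (∀ a b : Fin n → ℝ,
      a ∉ closure (Coamoeba.periodicLift (Coamoeba.coamoeba f)) →
      b ∉ closure (Coamoeba.periodicLift (Coamoeba.coamoeba f)) →
      (segment ℝ a b ∩ closure (Coamoeba.periodicLift (Coamoeba.coamoeba f))).Nonempty →
      ∃ Γ : Set (Fin n → ℝ), Coamoeba.IsEdge f Γ ∧
        (segment ℝ a b ∩
          Coamoeba.periodicLift (Coamoeba.coamoeba (Coamoeba.truncation f Γ))).Nonempty) ∧
    -- cells and components in `ℝ^n`
    (∀ C ∈ Coamoeba.complComponents (Coamoeba.periodicLift (Coamoeba.shell f)),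
      {Θ ∈ Coamoeba.complComponents (closure (Coamoeba.periodicLift (Coamoeba.coamoeba f))) |
        Θ ⊆ C}.Subsingleton) ∧
    -- cells and components in `T^n`
    (∀ C ∈ Coamoeba.complComponents (Coamoeba.shell f),
      {Θ ∈ Coamoeba.complComponents (closure (Coamoeba.coamoeba f)) | Θ ⊆ C}.Subsingleton) := by
  refine ⟨fun a b ha hb h => Coamoeba.exists_mem_segment_shell ha hb h, ?_, ?_⟩
  · rintro _ ⟨c, hc, rfl⟩
    refine Coamoeba.subsingleton_complComponents fun x hx y hy hx' hy' => ?_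
    exact (convex_segment (𝕜 := ℝ) x y).isPreconnected.subset_connectedComponentIn
      (left_mem_segment ℝ x y)
      (Coamoeba.IsPreconnected.segment_subset_compl_closure isPreconnected_connectedComponentIn
        (connectedComponentIn_subset _ _) hx hy hx' hy')
      (right_mem_segment ℝ x y)
  · rintro _ ⟨c, hc, rfl⟩
    exact Coamoeba.subsingleton_complComponents fun x hx y hy hx' hy' =>
      Coamoeba.mem_connectedComponentIn_of_cell hx hy hx' hy'
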